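/- Let $X=\ell^2(\mathbb{Z})$ be the complex Hilbert space with standard orthonormal basis $(e_i)_{i\in\mathbb{Z}}$, let $\mathcal{K}(X)$ be the set of compact linear operators on $X$, and for a bounded linear operator $A$ on $X$ define the numerical range $$N(A):=\operatorname{clos}\{\langle Ax,x\rangle : x\in X,\ \|x\|=1\}\subseteq\mathbb{C}.$$ Call $A$ a band operator if only finitely many of its diagonals $(\langle Ae_i,e_{i+k}\rangle)_{i\in\mathbb{Z}}$, $k\in\mathbb{Z}$, are non-zero. For $k\in\mathbb{Z}$ let $V_k$ be the shift $(V_kx)_j=x_{j-k}$. A bounded linear operator $B$ on $X$ is a limit operator of $A$ if there is a sequence $(h_m)_{m\in\mathbb{N}}$ of integers with $|h_m|\to\infty$ such that $V_{-h_m}AV_{h_m}x\to Bx$ for every $x\in X$; the set of all limit operators of $A$ is denoted by $\sigma^{\mathrm{op}}(A)$. Theorem. For every bounded band operator $A$ on $\ell^2(\mathbb{Z})$, $$\bigcap_{K\in\mathcal{K}(X)} N(A+K)=\operatorname{conv}\Bigl(\bigcup_{B\in\sigma^{\mathrm{op}}(A)}N(B)\Bigr),$$ where $\operatorname{conv}$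 denotes the convex hull (no closure is taken). -/

import Mathlib

open Filter Topology

noncomputable section

namespace BandOperator

/-- The complex Hilbert space `ℓ²(ℤ)`. -/
abbrev X : Type := lp (fun _ : ℤ => ℂ) 2

/-- The standard orthonormal basis vector `e_j`. -/
def e (j : ℤ) : X := lp.single 2 j (1 : ℂ)

/-- The matrix entry `A_{i,j} = ⟨A e_j, e_i⟩`. Mathlib's inner product is conjugate-linear in its
first argument, so the arguments appear in the opposite order. -/
def entry (A : X →L[ℂ] X) (i j : ℤ) : ℂ := inner ℂ (e i) (A (e j))

/-- A bounded operator is a band operator if only finitely many of its diagonals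
`(A_{i+k,i})_{i ∈ ℤ}` are non-zero. -/
def IsBandOperator (A : X →L[ℂ] X) : Prop :=
  {k : ℤ | (fun i : ℤ => entry A (i + k) i) ≠ 0}.Finite

theorem memlp_shift (k : ℤ) (x : X) : Memℓp (fun j : ℤ => x (j - k)) 2 := by
  have h : Summable (fun j : ℤ => ‖x j‖ ^ (2 : ENNReal).toReal) :=
    (lp.memℓp x).summable (by norm_num)
  exact memℓp_gen ((Equiv.subRight k).summable_iff.mpr h)

theorem norm_shift (k : ℤ) (x : X) :
    ‖(⟨fun j : ℤ => x (j - k), memlp_shift k x⟩ : X)‖ = ‖x‖ := by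
  rw [lp.norm_eq_tsum_rpow (by norm_num), lp.norm_eq_tsum_rpow (by norm_num)]
  congr 1
  exact (Equiv.subRight k).tsum_eq (fun j : ℤ => ‖x j‖ ^ (2 : ENNReal).toReal)

/-- The `k`-th shift operator, `(V_k x)_j = x_{j-k}`. -/
def shift (k : ℤ) : X →L[ℂ] X :=
  LinearIsometry.toContinuousLinearMap
    { toFun := fun x => ⟨fun j : ℤ => x (j - k), memlp_shift k x⟩
      map_add' := fun _ _ => rfl
      map_smul' := fun _ _ => rfl
      norm_map' := norm_shift k }

/-- `B` is the limit operator `A_h`: the sequence of integers `h` tends to infinity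
(that is, `|h_m| → ∞`) and `V_{-h_m} A V_{h_m} → B` strongly. -/
def IsLimitOperatorAlong (A : X →L[ℂ] X) (h : ℕ → ℤ) (B : X →L[ℂ] X) : Prop :=
  Tendsto (fun m => |h m|) atTop atTop ∧
    ∀ x : X, Tendsto (fun m => shift (-h m) (A (shift (h m) x))) atTop (𝓝 (B x))

/-- The operator spectrum of `A`: the set of all limit operators of `A`. -/
def operatorSpectrum (A : X →L[ℂ] X) : Set (X →L[ℂ] X) :=
  {B | ∃ h : ℕ → ℤ, IsLimitOperatorAlong A h B}

/-- The (closed) numerical range `N(A) = clos {⟨A x, x⟩ : ‖x‖ = 1}`, where `⟨A x, x⟩` is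
linear in `A x`. -/
def numericalRange (A : X →L[ℂ] X) : Set ℂ :=
  closure {z : ℂ | ∃ x : X, ‖x‖ = 1 ∧ z = inner ℂ x (A x)}

end BandOperator

end

open Filter Topology

noncomputable section

namespace BandOperator

/-! ### Slices, supporting functionals and Minkowski's theorem. -/

section ConvexGeometry

variable {E : Type*} [NormedAddCommGroup E] [NormedSpace ℝ E]

/-! One inclusion is soft. Translates `V_{h_m} x` tend weakly to zero, so a compact `K` does not
affect the limit of the forms along them, and `N(B) ⊆ N(A + K)`; the Toeplitz-Hausdorff theorem then
admits the convex hull.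

For the other, let `W` be the intersection of the sets `outerHull A n`. A compact perturbation can
remove the part of `A` that touches `[-n, n]`, so the left side lies in `W`
(`iInter_numericalRange_subset_outerHull`). As `W` is a compact convex subset of the plane,
Minkowski's theorem writes it as the hull of its extreme points without closure. It remains to find,
for each extreme point `a`, one limit operator `B` with `a ∈ N(B)`.

Some functional cuts off a small slice of `W` at `a`. Averaging a band operator's form over windows
of length `D` costs only `O(1/D)`, so a vector whose value lies deep in the slice has a window whose
value stays in it (`exists_window`), with `D` depending only on the tolerance. Cutting repeatedly,
with tolerances `ε N, ..., ε 0`, gives nested windows around a common index `j`, and `|j| → ∞` as `N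
→ ∞`. Translating by `j` and passing to a subsequence yields a `B` that has, for every `k`, values
near `a` at vectors supported in a fixed window of level `k`. A single `B` thus serves all
tolerances, which is why no closure is needed. -/

theorem isCompact_convexJoin {s t : Set E} (hs : IsCompact s) (ht : IsCompact t) :
    IsCompact (convexJoin ℝ s t) := by
  have h : convexJoin ℝ s t =
      (fun p : ℝ × E × E => (1 - p.1) • p.2.1 + p.1 • p.2.2) '' (Set.Icc 0 1 ×ˢ s ×ˢ t) := by
    ext z
    simp only [mem_convexJoin, segment_eq_image, Set.mem_image, Set.mem_prod, Prod.exists]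
    constructor
    · rintro ⟨x, hx, y, hy, θ, hθ, rfl⟩
      exact ⟨θ, x, y, ⟨hθ, hx, hy⟩, rfl⟩
    · rintro ⟨θ, x, y, ⟨hθ, hx, hy⟩, rfl⟩
      exact ⟨x, hx, y, hy, θ, hθ, rfl⟩
  rw [h]
  exact (isCompact_Icc.prod (hs.prod ht)).image (by fun_prop)

/-- The open slices of a compact convex set at an extreme point form a neighbourhood basis. -/
theorem exists_slice_subset_ball {W : Set E} (hW : IsCompact W) (hconv : Convex ℝ W) {a : E}
    (ha : a ∈ W.extremePoints ℝ) {ε : ℝ} (hε : 0 < ε) :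
    ∃ (f : StrongDual ℝ E) (s : ℝ), s < f a ∧ ∀ p ∈ W, s ≤ f p → dist p a < ε := by
  have haW := (hconv.mem_extremePoints_iff_mem_sdiff_convexHull_sdiff.mp ha).2
  obtain ⟨C, hC, hCc, hsub, hCW⟩ : ∃ C : Set E, IsCompact C ∧ Convex ℝ C ∧
      W \ Metric.ball a ε ⊆ C ∧ C ⊆ convexHull ℝ (W \ {a}) := by
    -- Compactness induction: small pieces of `W` are joined pairwise by `convexJoin`, which keeps
    -- them compact and convex, so no finite dimension is needed.
    refine (hW.diff Metric.isOpen_ball).induction_on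
      (p := fun t => ∃ C : Set E, IsCompact C ∧ Convex ℝ C ∧ t ⊆ C ∧ C ⊆ convexHull ℝ (W \ {a}))
      ?_ ?_ ?_ ?_
    · exact ⟨∅, isCompact_empty, convex_empty, subset_rfl, Set.empty_subset _⟩
    · rintro s t hst ⟨C, h1, h2, h3, h4⟩
      exact ⟨C, h1, h2, hst.trans h3, h4⟩
    · rintro s t ⟨C, h1, h2, h3, h4⟩ ⟨D, k1, k2, k3, k4⟩
      rcases C.eq_empty_or_nonempty with rfl | hCn
      · exact ⟨D, k1, k2, by rw [Set.subset_empty_iff.mp h3, Set.empty_union]; exact k3, k4⟩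
      rcases D.eq_empty_or_nonempty with rfl | hDn
      · exact ⟨C, h1, h2, by rw [Set.subset_empty_iff.mp k3, Set.union_empty]; exact h3, h4⟩
      refine ⟨convexJoin ℝ C D, isCompact_convexJoin h1 k1, h2.convexJoin k2,
        Set.union_subset (h3.trans (subset_convexJoin_left hDn))
          (k3.trans (subset_convexJoin_right hCn)),
        (convexJoin_mono h4 k4).trans
          (convexJoin_subset subset_rfl subset_rfl (convex_convexHull ℝ _))⟩
    · intro x hx
      -- Radius `ε / 2` keeps `a` out of the piece, since `dist x a ≥ ε`.
      refine ⟨W ∩ Metric.closedBall x (ε / 2), ?_, W ∩ Metric.closedBall x (ε / 2),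
        hW.inter_right Metric.isClosed_closedBall, hconv.inter (convex_closedBall _ _),
        subset_rfl, ?_⟩
      · refine mem_nhdsWithin.mpr ⟨Metric.ball x (ε / 2), Metric.isOpen_ball,
          Metric.mem_ball_self (by positivity), ?_⟩
        rintro y ⟨hy, hyW⟩
        exact ⟨hyW.1, Metric.ball_subset_closedBall hy⟩
      · refine Set.Subset.trans ?_ (subset_convexHull ℝ _)
        rintro y ⟨hyW, hy⟩
        refine ⟨hyW, fun h => ?_⟩
        rw [Set.mem_singleton_iff] at h
        subst h
        have h2 := hx.2
        rw [Metric.mem_ball, not_lt] at h2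
        rw [Metric.mem_closedBall, dist_comm] at hy
        linarith
  obtain ⟨f, s, h1, h2⟩ := geometric_hahn_banach_closed_point hCc hC.isClosed
    (fun h => haW (hCW h))
  refine ⟨f, s, h2, fun p hp hsp => ?_⟩
  by_contra hdist
  exact absurd (h1 p (hsub ⟨hp, hdist⟩)) (not_lt.mpr hsp)

/-- The slice form of extremality for the intersection of a decreasing sequence of compact convex
sets. -/
theorem exists_slice_of_iInter {C : ℕ → Set E} (hC : ∀ n, IsCompact (C n))
    (hconv : ∀ n, Convex ℝ (C n)) (hanti : Antitone C) {a : E}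
    (ha : a ∈ (⋂ n, C n).extremePoints ℝ) {ε : ℝ} (hε : 0 < ε) :
    ∃ (f : StrongDual ℝ E) (s : ℝ) (n : ℕ), s < f a ∧ ∀ p ∈ C n, s ≤ f p → dist p a < ε := by
  have hW : IsCompact (⋂ n, C n) := (hC 0).of_isClosed_subset (isClosed_iInter fun n => (hC n).isClosed)
    (Set.iInter_subset C 0)
  obtain ⟨f, s, hs, hf⟩ := exists_slice_subset_ball hW (convex_iInter hconv) ha hε
  have hcl : IsClosed {p : E | s ≤ f p} := isClosed_le continuous_const f.continuous
  obtain ⟨n, hn⟩ := exists_subset_nhds_of_isCompact (V := fun n => C n ∩ {p : E | s ≤ f p})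
    (U := Metric.ball a ε)
    (directed_of_isDirected_le fun i j hij => Set.inter_subset_inter_left _ (hanti hij))
    (fun n => (hC n).inter_right hcl)
    (fun x hx => by
      rw [Set.mem_iInter] at hx
      exact Metric.isOpen_ball.mem_nhds
        (hf x (Set.mem_iInter.mpr fun n => (hx n).1) (hx 0).2))
  exact ⟨f, s, n, hs, fun p hp hsp => hn ⟨hp, hsp⟩⟩

theorem mem_extremePoints_of_isMinOn {K : Set E} {g : E →L[ℝ] ℝ} {p : E}
    (hp : p ∈ K) (hmin : ∀ x ∈ K, g p ≤ g x) (hinj : ∀ x ∈ K, g x = g p → x = p) :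
    p ∈ K.extremePoints ℝ := by
  rw [mem_extremePoints]
  refine ⟨hp, fun x hx y hy hxy => ?_⟩
  obtain ⟨α, β, hα, hβ, hαβ, h⟩ := hxy
  have hg : α * g x + β * g y = g p := by rw [← h]; simp
  have h1 := hmin x hx
  have h2 := hmin y hy
  have e : α * (g x - g p) + β * (g y - g p) = 0 := by
    have : (α + β) * g p = g p := by rw [hαβ, one_mul]
    linarith
  have e1 : 0 ≤ α * (g x - g p) := mul_nonneg hα.le (by linarith)
  have e2 : 0 ≤ β * (g y - g p) := mul_nonneg hβ.le (by linarith)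
  constructor
  · refine hinj x hx ?_
    have : α * (g x - g p) = 0 := by linarith
    rcases mul_eq_zero.mp this with h | h <;> linarith
  · refine hinj y hy ?_
    have : β * (g y - g p) = 0 := by linarith
    rcases mul_eq_zero.mp this with h | h <;> linarith

/-- Minkowski's theorem on a line with coordinate `g`: the minimiser and maximiser are extreme, and
every other point lies between them. Injectivity is asked on the hull because `K` need not be
convex. -/
theorem subset_convexHull_extremePoints_of_injOn {K : Set E} (hK : IsCompact K)
    (g : E →L[ℝ] ℝ) (hinj : Set.InjOn g (convexHull ℝ K)) :
    K ⊆ convexHull ℝ (K.extremePoints ℝ) := by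
  intro z hz
  have hsub := subset_convexHull ℝ K
  obtain ⟨p, hp, hpmin⟩ := hK.exists_isMinOn ⟨z, hz⟩ g.continuous.continuousOn
  obtain ⟨q, hq, hqmax⟩ := hK.exists_isMaxOn ⟨z, hz⟩ g.continuous.continuousOn
  have hpz : g p ≤ g z := hpmin hz
  have hzq : g z ≤ g q := hqmax hz
  have hpe : p ∈ K.extremePoints ℝ := mem_extremePoints_of_isMinOn hp (fun x hx => hpmin hx)
    (fun x hx h => hinj (hsub hx) (hsub hp) h)
  have hqe : q ∈ K.extremePoints ℝ := mem_extremePoints_of_isMinOn (g := -g) hq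
    (fun x hx => by simpa using hqmax hx)
    (fun x hx h => hinj (hsub hx) (hsub hq) (by simpa using h))
  obtain ⟨α, β, hα, hβ, hαβ, h⟩ : g z ∈ segment ℝ (g p) (g q) := by
    rw [segment_eq_Icc (hpz.trans hzq)]
    exact ⟨hpz, hzq⟩
  have hz' : z = α • p + β • q :=
    hinj (hsub hz) ((convex_convexHull ℝ K) (hsub hp) (hsub hq) hα hβ hαβ) (by simpa using h.symm)
  rw [hz']
  exact convex_convexHull ℝ _ (subset_convexHull ℝ _ hpe) (subset_convexHull ℝ _ hqe) hα hβ hαβ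

/-- With interior this is Hahn-Banach. Without interior the affine span is proper, and a non-zero
functional killing its direction is constant on `closure C`. -/
theorem exists_supporting_functional [FiniteDimensional ℝ E] {C : Set E} (hC : Convex ℝ C)
    {z : E} (hz : z ∉ C) (hzC : z ∈ closure C) :
    ∃ f : E →L[ℝ] ℝ, f ≠ 0 ∧ ∀ x ∈ closure C, f x ≤ f z := by
  obtain ⟨f, hf0, hf⟩ : ∃ f : E →L[ℝ] ℝ, f ≠ 0 ∧ ∀ x ∈ C, f x ≤ f z := by
    by_cases hint : (interior C).Nonempty
    · obtain ⟨f, hf0, hf⟩ := geometric_hahn_banach_of_nonempty_interior_point hC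
        (fun h => hz (interior_subset h)) hint
      exact ⟨f, hf0, fun x hx => hf x hx⟩
    · rw [hC.interior_nonempty_iff_affineSpan_eq_top] at hint
      obtain ⟨c, hc⟩ : C.Nonempty := closure_nonempty_iff.mp ⟨z, hzC⟩
      have hdir : (affineSpan ℝ C).direction < ⊤ := by
        rw [lt_top_iff_ne_top]
        intro h
        exact hint ((AffineSubspace.direction_eq_top_iff_of_nonempty
          ⟨c, subset_affineSpan ℝ C hc⟩).mp h)
      obtain ⟨f, hf0, hf⟩ := Submodule.exists_le_ker_of_lt_top _ hdir
      have key : ∀ x ∈ C, LinearMap.toContinuousLinearMap f x =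
          LinearMap.toContinuousLinearMap f c := by
        intro x hx
        have : x -ᵥ c ∈ (affineSpan ℝ C).direction :=
          AffineSubspace.vsub_mem_direction (subset_affineSpan ℝ C hx) (subset_affineSpan ℝ C hc)
        have h0 := hf this
        rw [LinearMap.mem_ker, vsub_eq_sub, map_sub, sub_eq_zero] at h0
        exact h0
      have hzc : LinearMap.toContinuousLinearMap f z = LinearMap.toContinuousLinearMap f c :=
        closure_minimal (t := {x | LinearMap.toContinuousLinearMap f x =
          LinearMap.toContinuousLinearMap f c}) key
          (isClosed_eq (ContinuousLinearMap.continuous _) continuous_const) hzC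
      refine ⟨LinearMap.toContinuousLinearMap f, fun h => hf0 ?_, fun x hx => ?_⟩
      · ext x
        exact DFunLike.congr_fun h x
      · rw [key x hx, hzc]
  exact ⟨f, hf0, closure_minimal (t := {x | f x ≤ f z}) hf
    (isClosed_le f.continuous continuous_const)⟩

/-- Minkowski's theorem in the plane: a compact convex set is the convex hull of its extreme
points. -/
theorem subset_convexHull_extremePoints {W : Set ℂ} (hW : IsCompact W) (hconv : Convex ℝ W) :
    W ⊆ convexHull ℝ (W.extremePoints ℝ) := by
  intro z hz
  by_contra hzC
  have hcl := closure_convexHull_extremePoints hW hconv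
  obtain ⟨f, hf0, hf⟩ := exists_supporting_functional (convex_convexHull ℝ _) hzC
    (by rw [hcl]; exact hz)
  rw [hcl] at hf
  have hFc : IsClosed {x : ℂ | f x = f z} := isClosed_eq f.continuous continuous_const
  have hF : IsCompact (W ∩ {x : ℂ | f x = f z}) := hW.inter_right hFc
  have hFconv : Convex ℝ {x : ℂ | f x = f z} := convex_hyperplane f.isLinear _
  -- `f` and `g` together separate points of the plane, so `g` is a coordinate on the supporting
  -- line.
  let g : ℂ →L[ℝ] ℝ := f.comp ((ContinuousLinearMap.mul ℝ ℂ) Complex.I)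
  have hg : ∀ x, g x = f (Complex.I * x) := fun x => rfl
  have hinj : ∀ x y : ℂ, f x = f y → g x = g y → x = y := by
    intro x y h1 h2
    by_contra hne
    apply hf0
    have e1 : f (x - y) = 0 := by rw [map_sub, h1, sub_self]
    have e2 : f (Complex.I * (x - y)) = 0 := by
      rw [mul_sub, map_sub, ← hg, ← hg, h2, sub_self]
    ext w
    have hw : w = (w / (x - y)).re • (x - y) + (w / (x - y)).im • (Complex.I * (x - y)) := by
      have h3 : w / (x - y) * (x - y) = w := div_mul_cancel₀ _ (sub_ne_zero.mpr hne)
      conv_lhs => rw [← h3, ← Complex.re_add_im (w / (x - y))]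
      simp only [Complex.real_smul]
      ring
    rw [hw, map_add, map_smul, map_smul, e1, e2]
    simp
  have hsubset := subset_convexHull_extremePoints_of_injOn hF g (by
    intro x hx y hy hxy
    have hx' := convexHull_min Set.inter_subset_right hFconv hx
    have hy' := convexHull_min Set.inter_subset_right hFconv hy
    exact hinj x y (by rw [hx', hy']) hxy)
  have hext : IsExtreme ℝ W (W ∩ {x : ℂ | f x = f z}) := by
    refine ⟨Set.inter_subset_left, ?_⟩
    rintro x hx y hy p ⟨hpW, hp⟩ ⟨α, β, hα, hβ, hαβ, h⟩
    refine ⟨hx, ?_⟩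
    change f p = f z at hp
    change f x = f z
    have h1 := hf x hx
    have h2 := hf y hy
    have e : α * f x + β * f y = f z := by rw [← hp, ← h, map_add, map_smul, map_smul]; rfl
    have e2 : α * (f z - f x) + β * (f z - f y) = 0 := by
      have : (α + β) * f z = f z := by rw [hαβ, one_mul]
      linarith
    have e3 : 0 ≤ β * (f z - f y) := mul_nonneg hβ.le (by linarith)
    have e4 : 0 ≤ α * (f z - f x) := mul_nonneg hα.le (by linarith)
    have : α * (f z - f x) = 0 := by linarith
    rcases mul_eq_zero.mp this with h | h <;> linarith
  exact hzC (convexHull_mono hext.extremePoints_subset_extremePoints (hsubset ⟨hz, rfl⟩))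

end ConvexGeometry

/-! ### Coordinates, truncations and the quadratic form. -/

section Coordinates

theorem e_apply (i j : ℤ) : e j i = if i = j then 1 else 0 := by
  unfold e
  rw [lp.single_apply]
  by_cases h : i = j
  · subst h; simp
  · simp [h]

theorem inner_e_left (i : ℤ) (x : X) : inner ℂ (e i) x = x i := by
  unfold e
  rw [lp.inner_single_left]
  simp

theorem inner_e_right (i : ℤ) (x : X) : inner ℂ x (e i) = (starRingEnd ℂ) (x i) := by
  rw [← inner_conj_symm, inner_e_left]

theorem norm_e (i : ℤ) : ‖e i‖ = 1 := by
  unfold e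
  rw [lp.norm_single (by norm_num)]
  simp

theorem norm_apply_le (x : X) (i : ℤ) : ‖x i‖ ≤ ‖x‖ := by
  rw [← inner_e_left]
  simpa [norm_e] using norm_inner_le_norm (𝕜 := ℂ) (e i) x

theorem norm_entry_le (A : X →L[ℂ] X) (i j : ℤ) : ‖entry A i j‖ ≤ ‖A‖ := by
  unfold entry
  rw [inner_e_left]
  refine (norm_apply_le _ _).trans ?_
  simpa [norm_e] using A.le_opNorm (e j)

/-- A band operator has a finite band-width. -/
theorem IsBandOperator.exists_width {A : X →L[ℂ] X} (hA : IsBandOperator A) :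
    ∃ w : ℕ, ∀ i j : ℤ, (w : ℤ) < |i - j| → entry A i j = 0 := by
  obtain ⟨w, hw⟩ := (hA.image Int.natAbs).bddAbove
  refine ⟨w, fun i j hij => ?_⟩
  by_contra h
  have hmem : i - j ∈ {k : ℤ | (fun i : ℤ => entry A (i + k) i) ≠ 0} := by
    intro h0
    have := congrFun h0 j
    simp only [add_sub_cancel, Pi.zero_apply] at this
    exact h this
  have : Int.natAbs (i - j) ≤ w := hw (Set.mem_image_of_mem _ hmem)
  rw [Int.abs_eq_natAbs] at hij
  omega

/-- The coordinate projection onto the span of `e_j`, `j ∈ s`. -/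
def trunc (s : Finset ℤ) : X →L[ℂ] X :=
  ∑ j ∈ s, (innerSL ℂ (e j)).smulRight (e j)

theorem trunc_apply (s : Finset ℤ) (x : X) : trunc s x = ∑ j ∈ s, x j • e j := by
  simp [trunc, inner_e_left]

theorem trunc_coord (s : Finset ℤ) (x : X) (i : ℤ) :
    trunc s x i = if i ∈ s then x i else 0 := by
  rw [← inner_e_left, trunc_apply, inner_sum]
  simp only [inner_smul_right, inner_e_left, e_apply]
  simp

theorem isCompactOperator_trunc (s : Finset ℤ) : IsCompactOperator (trunc s) := by
  unfold trunc
  induction s using Finset.induction_on with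
  | empty => simpa using isCompactOperator_zero
  | insert j s hj ih =>
    rw [Finset.sum_insert hj]
    refine IsCompactOperator.add ?_ ih
    have h : IsCompactOperator (ContinuousLinearMap.toSpanSingleton ℂ (e j)) :=
      isCompactOperator_of_locallyCompactSpace_rng _
    exact h.comp_clm (innerSL ℂ (e j))

theorem tendsto_trunc (x : X) : Tendsto (fun s => trunc s x) atTop (𝓝 x) := by
  have h := lp.hasSum_single (p := 2) (by norm_num) x
  rw [HasSum, SummationFilter.unconditional_filter] at h
  refine h.congr fun s => ?_
  rw [trunc_apply]
  refine Finset.sum_congr rfl fun j _ => ?_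
  rw [e, ← lp.single_smul]
  simp

theorem inner_trunc_left (s : Finset ℤ) (x y : X) :
    inner ℂ (trunc s x) y = ∑ j ∈ s, (starRingEnd ℂ) (x j) * y j := by
  rw [trunc_apply, sum_inner]
  simp only [inner_smul_left, inner_e_left]

theorem inner_trunc_right (s : Finset ℤ) (x y : X) :
    inner ℂ x (trunc s y) = inner ℂ (trunc s x) y := by
  rw [inner_trunc_left, trunc_apply, inner_sum]
  simp only [inner_smul_right, inner_e_right]
  exact Finset.sum_congr rfl fun j _ => mul_comm _ _

theorem trunc_trunc (s : Finset ℤ) (x : X) : trunc s (trunc s x) = trunc s x := by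
  ext i
  simp only [trunc_coord]
  split_ifs <;> rfl

theorem inner_trunc_self (s : Finset ℤ) (x : X) :
    inner ℂ x (trunc s x) = ((‖trunc s x‖ ^ 2 : ℝ) : ℂ) := by
  rw [← trunc_trunc, inner_trunc_right, inner_self_eq_norm_sq_to_K]
  rw [trunc_trunc]
  norm_cast

theorem norm_sq_trunc (s : Finset ℤ) (x : X) : ‖trunc s x‖ ^ 2 = ∑ j ∈ s, ‖x j‖ ^ 2 := by
  have h := inner_trunc_self s x
  rw [inner_trunc_right, inner_trunc_left] at h
  have h2 : (∑ j ∈ s, (starRingEnd ℂ) (x j) * x j) = ((∑ j ∈ s, ‖x j‖ ^ 2 : ℝ) : ℂ) := by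
    push_cast
    refine Finset.sum_congr rfl fun j _ => ?_
    rw [mul_comm, Complex.mul_conj, Complex.normSq_eq_norm_sq]
    push_cast; rfl
  rw [h2] at h
  exact_mod_cast h.symm

theorem norm_sq_add_norm_sq_sub_trunc (s : Finset ℤ) (x : X) :
    ‖trunc s x‖ ^ 2 + ‖x - trunc s x‖ ^ 2 = ‖x‖ ^ 2 := by
  have h : inner ℂ (trunc s x) (x - trunc s x) = 0 := by
    rw [inner_sub_right, inner_trunc_right, trunc_trunc, sub_self]
  have := norm_add_sq_eq_norm_sq_add_norm_sq_of_inner_eq_zero _ _ h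
  rw [add_sub_cancel] at this
  nlinarith

theorem form_trunc (A : X →L[ℂ] X) (s : Finset ℤ) (x : X) :
    inner ℂ (trunc s x) (A (trunc s x)) =
      ∑ i ∈ s, ∑ j ∈ s, (starRingEnd ℂ) (x i) * x j * entry A i j := by
  rw [trunc_apply, map_sum, sum_inner]
  refine Finset.sum_congr rfl fun i _ => ?_
  rw [inner_sum]
  refine Finset.sum_congr rfl fun j _ => ?_
  rw [map_smul, inner_smul_left, inner_smul_right, entry, mul_assoc]

theorem form_smul (A : X →L[ℂ] X) (r : ℝ) (x : X) :
    inner ℂ ((r : ℂ) • x) (A ((r : ℂ) • x)) = ((r ^ 2 : ℝ) : ℂ) * inner ℂ x (A x) := by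
  rw [map_smul, inner_smul_left, inner_smul_right, Complex.conj_ofReal]
  push_cast; ring

/-- A non-zero vector can be normalised, which divides the quadratic form by `‖x‖²`. -/
theorem exists_unit_form (A : X →L[ℂ] X) {x : X} (hx : x ≠ 0) :
    ∃ u : X, ‖u‖ = 1 ∧ inner ℂ x (A x) = ((‖x‖ ^ 2 : ℝ) : ℂ) * inner ℂ u (A u) ∧
      ∀ i, x i = 0 → u i = 0 := by
  have hn : ‖x‖ ≠ 0 := norm_ne_zero_iff.mpr hx
  refine ⟨((‖x‖⁻¹ : ℝ) : ℂ) • x, ?_, ?_, ?_⟩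
  · rw [norm_smul, Complex.norm_real, norm_inv, norm_norm, inv_mul_cancel₀ hn]
  · rw [form_smul, ← mul_assoc, ← Complex.ofReal_mul, ← mul_pow, mul_inv_cancel₀ hn]
    simp
  · intro i hi
    rw [lp.coeFn_smul, Pi.smul_apply, hi, smul_zero]

end Coordinates

/-! ### Averaging the form over windows. -/

section Windows

/-- The number of windows of length `D` that contain both `i` and `j` differs from `D` by at most
`|i - j|`. -/
theorem abs_card_windows_sub_le (D : ℕ) (i j : ℤ) :
    |((Finset.Ioc (i - D) i ∩ Finset.Ioc (j - D) j).card : ℝ) - D| ≤ (|i - j| : ℤ) := by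
  rw [Finset.Ioc_inter_Ioc, Int.card_Ioc]
  have h : |((((i ⊓ j) - ((i - D) ⊔ (j - D))).toNat : ℤ)) - (D : ℤ)| ≤ |i - j| := by
    rw [abs_le]
    rcases abs_cases (i - j) with h | h <;> constructor <;> omega
  generalize ((i ⊓ j) - ((i - D) ⊔ (j - D))).toNat = n at h ⊢
  have h2 : ((|(n : ℤ) - (D : ℤ)| : ℤ) : ℝ) ≤ ((|i - j| : ℤ) : ℝ) := Int.cast_le.mpr h
  simpa using h2

/-- The left end points of the windows of length `D` that meet `F`. -/
def windowStarts (F : Finset ℤ) (D : ℕ) : Finset ℤ := F.biUnion fun i => Finset.Ioc (i - D) i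

/-- The window `[m, m + D)` contains `i` exactly when `m ∈ (i - D, i]`; `i ∈ F` ensures that all
such `m` are among the starts. -/
theorem sum_window_indicator (F : Finset ℤ) (D : ℕ) {i j : ℤ} (hi : i ∈ F) :
    (∑ m ∈ windowStarts F D,
      if i ∈ Finset.Ico m (m + D) ∧ j ∈ Finset.Ico m (m + D) then (1 : ℂ) else 0) =
      ((Finset.Ioc (i - D) i ∩ Finset.Ioc (j - D) j).card : ℂ) := by
  rw [Finset.sum_boole]
  congr 2
  ext m
  simp only [windowStarts, Finset.mem_filter, Finset.mem_biUnion, Finset.mem_inter,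
    Finset.mem_Ioc, Finset.mem_Ico]
  constructor
  · rintro ⟨-, h⟩
    omega
  · rintro h
    exact ⟨⟨i, hi, by omega⟩, by omega⟩

theorem trunc_eq_trunc_filter {F : Finset ℤ} {x : X} (hx : trunc F x = x) (s : Finset ℤ) :
    trunc s x = trunc (F.filter (· ∈ s)) x := by
  ext i
  have h : x i = if i ∈ F then x i else 0 := by rw [← trunc_coord, hx]
  simp only [trunc_coord, Finset.mem_filter]
  by_cases h1 : i ∈ F <;> by_cases h2 : i ∈ s <;> simp_all

theorem sum_form_windows (A : X →L[ℂ] X) {F : Finset ℤ} {x : X} (hx : trunc F x = x) (D : ℕ) :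
    ∑ m ∈ windowStarts F D,
      inner ℂ (trunc (Finset.Ico m (m + D)) x) (A (trunc (Finset.Ico m (m + D)) x)) =
    ∑ i ∈ F, ∑ j ∈ F, ((Finset.Ioc (i - D) i ∩ Finset.Ioc (j - D) j).card : ℂ) *
      ((starRingEnd ℂ) (x i) * x j * entry A i j) := by
  have h1 : ∀ m : ℤ,
      inner ℂ (trunc (Finset.Ico m (m + D)) x) (A (trunc (Finset.Ico m (m + D)) x)) =
      ∑ i ∈ F, ∑ j ∈ F,
        (if i ∈ Finset.Ico m (m + D) ∧ j ∈ Finset.Ico m (m + D) then (1 : ℂ) else 0) *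
          ((starRingEnd ℂ) (x i) * x j * entry A i j) := by
    intro m
    rw [trunc_eq_trunc_filter hx, form_trunc, Finset.sum_filter]
    refine Finset.sum_congr rfl fun i _ => ?_
    rw [Finset.sum_filter]
    split_ifs with h
    · refine Finset.sum_congr rfl fun j _ => ?_
      simp only [h, true_and, ite_mul, one_mul, zero_mul]
    · simp [h]
  simp only [h1]
  rw [Finset.sum_comm]
  refine Finset.sum_congr rfl fun i hi => ?_
  rw [Finset.sum_comm]
  refine Finset.sum_congr rfl fun j _ => ?_
  rw [← Finset.sum_mul, sum_window_indicator F D hi]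

theorem sum_norm_sq_windows {F : Finset ℤ} {x : X} (hx : trunc F x = x) (D : ℕ) :
    ∑ m ∈ windowStarts F D, ‖trunc (Finset.Ico m (m + D)) x‖ ^ 2 = D * ‖x‖ ^ 2 := by
  have h1 : ∀ m : ℤ, ‖trunc (Finset.Ico m (m + D)) x‖ ^ 2 =
      ∑ i ∈ F, (if i ∈ Finset.Ico m (m + D) then 1 else 0) * ‖x i‖ ^ 2 := by
    intro m
    rw [trunc_eq_trunc_filter hx, norm_sq_trunc, Finset.sum_filter]
    exact Finset.sum_congr rfl fun i _ => by simp
  simp only [h1]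
  rw [Finset.sum_comm, ← hx, norm_sq_trunc, Finset.mul_sum, hx]
  refine Finset.sum_congr rfl fun i hi => ?_
  rw [← Finset.sum_mul]
  congr 1
  have h2 := sum_window_indicator F D (j := i) hi
  simp only [and_self, Finset.inter_self, Int.card_Ioc] at h2
  have h3 : ((i - (i - (D : ℤ))).toNat : ℂ) = D := by congr 1; omega
  rw [h3] at h2
  exact_mod_cast h2

theorem sum_sum_near_le (F : Finset ℤ) (w : ℕ) (a : ℤ → ℝ) (ha : ∀ i, 0 ≤ a i) :
    ∑ i ∈ F, ∑ j ∈ F, (if |i - j| ≤ (w : ℤ) then a i else 0) ≤ (2 * w + 1) * ∑ i ∈ F, a i := by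
  rw [Finset.mul_sum]
  refine Finset.sum_le_sum fun i _ => ?_
  rw [← Finset.sum_filter, Finset.sum_const, nsmul_eq_mul]
  refine mul_le_mul_of_nonneg_right ?_ (ha i)
  have hsub : F.filter (fun j => |i - j| ≤ (w : ℤ)) ⊆ Finset.Icc (i - w) (i + w) := by
    intro j hj
    have := (Finset.mem_filter.mp hj).2
    rw [abs_le] at this
    rw [Finset.mem_Icc]
    omega
  have hc := Finset.card_le_card hsub
  rw [Int.card_Icc] at hc
  have : (F.filter (fun j => |i - j| ≤ (w : ℤ))).card ≤ 2 * w + 1 := by omega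
  exact_mod_cast this

/-- Cutting a finitely supported vector into all windows of length `D` changes the averaged
quadratic form of a band operator by a quantity bounded independently of `D`. -/
theorem norm_sum_form_windows_sub_le (A : X →L[ℂ] X) {w : ℕ}
    (hw : ∀ i j : ℤ, (w : ℤ) < |i - j| → entry A i j = 0) {F : Finset ℤ} {x : X}
    (hx : trunc F x = x) (D : ℕ) :
    ‖(∑ m ∈ windowStarts F D,
      inner ℂ (trunc (Finset.Ico m (m + D)) x) (A (trunc (Finset.Ico m (m + D)) x))) -
      D * inner ℂ x (A x)‖ ≤ w * ‖A‖ * (2 * w + 1) * ‖x‖ ^ 2 := by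
  have hq : inner ℂ x (A x) =
      ∑ i ∈ F, ∑ j ∈ F, (starRingEnd ℂ) (x i) * x j * entry A i j := by
    rw [← form_trunc, hx]
  have hn : ‖x‖ ^ 2 = ∑ i ∈ F, ‖x i‖ ^ 2 := by rw [← norm_sq_trunc, hx]
  -- On the band the count misses `D` by at most `w`; off it the entry vanishes. The product `‖x i‖
  -- * ‖x j‖` is split by AM-GM so that `sum_sum_near_le` bounds each half.
  have hterm : ∀ i j : ℤ, ‖((Finset.Ioc (i - D) i ∩ Finset.Ioc (j - D) j).card : ℂ) *
        ((starRingEnd ℂ) (x i) * x j * entry A i j) -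
        D * ((starRingEnd ℂ) (x i) * x j * entry A i j)‖ ≤
      w * ‖A‖ * ((if |i - j| ≤ (w : ℤ) then ‖x i‖ ^ 2 else 0) / 2 +
        (if |j - i| ≤ (w : ℤ) then ‖x j‖ ^ 2 else 0) / 2) := by
    intro i j
    rw [abs_sub_comm j i]
    split_ifs with h
    · rw [← sub_mul, norm_mul, norm_mul, norm_mul, RCLike.norm_conj]
      have h1 : ‖((Finset.Ioc (i - D) i ∩ Finset.Ioc (j - D) j).card : ℂ) - D‖ ≤ w := by
        have h2 := abs_card_windows_sub_le D i j
        have h3 : ((|i - j| : ℤ) : ℝ) ≤ w := by exact_mod_cast h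
        have h4 : ‖((Finset.Ioc (i - D) i ∩ Finset.Ioc (j - D) j).card : ℂ) - D‖ =
          |((Finset.Ioc (i - D) i ∩ Finset.Ioc (j - D) j).card : ℝ) - D| := by
          rw [← Real.norm_eq_abs, ← Complex.norm_real]
          push_cast
          rfl
        rw [h4]
        exact h2.trans h3
      have h5 : ‖x i‖ * ‖x j‖ ≤ ‖x i‖ ^ 2 / 2 + ‖x j‖ ^ 2 / 2 := by
        nlinarith [sq_nonneg (‖x i‖ - ‖x j‖)]
      calc _ ≤ (w : ℝ) * ((‖x i‖ ^ 2 / 2 + ‖x j‖ ^ 2 / 2) * ‖A‖) := by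
            gcongr
            exact norm_entry_le A i j
        _ = _ := by ring
    · rw [hw i j (by omega)]
      simp
  rw [sum_form_windows A hx, hq, Finset.mul_sum, ← Finset.sum_sub_distrib]
  simp only [Finset.mul_sum, ← Finset.sum_sub_distrib]
  calc _ ≤ ∑ i ∈ F, ∑ j ∈ F, w * ‖A‖ * ((if |i - j| ≤ (w : ℤ) then ‖x i‖ ^ 2 else 0) / 2 +
        (if |j - i| ≤ (w : ℤ) then ‖x j‖ ^ 2 else 0) / 2) := by
        refine (norm_sum_le _ _).trans (Finset.sum_le_sum fun i _ => ?_)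
        exact (norm_sum_le _ _).trans (Finset.sum_le_sum fun j _ => hterm i j)
    _ = w * ‖A‖ * ((∑ i ∈ F, ∑ j ∈ F, if |i - j| ≤ (w : ℤ) then ‖x i‖ ^ 2 else 0) / 2 +
        (∑ i ∈ F, ∑ j ∈ F, if |j - i| ≤ (w : ℤ) then ‖x j‖ ^ 2 else 0) / 2) := by
        simp only [← Finset.mul_sum, Finset.sum_add_distrib, Finset.sum_div]
    _ ≤ w * ‖A‖ * ((2 * w + 1) * ∑ i ∈ F, ‖x i‖ ^ 2) := by
        rw [Finset.sum_comm (s := F) (t := F) (f := fun i j =>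
          if |j - i| ≤ (w : ℤ) then ‖x j‖ ^ 2 else 0)]
        have := sum_sum_near_le F w (fun i => ‖x i‖ ^ 2) (fun i => sq_nonneg _)
        gcongr
        linarith
    _ = _ := by rw [hn]; ring

/-- If a functional of the quadratic form exceeds `s` by enough, some window of `x` has the same
property. -/
theorem exists_window (A : X →L[ℂ] X) {w : ℕ}
    (hw : ∀ i j : ℤ, (w : ℤ) < |i - j| → entry A i j = 0) {F : Finset ℤ} {x : X}
    (hx : trunc F x = x) (hx1 : ‖x‖ = 1) (D : ℕ) (f : ℂ →L[ℝ] ℝ) (s : ℝ)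
    (hs : s * D + ‖f‖ * (w * ‖A‖ * (2 * w + 1)) < D * f (inner ℂ x (A x))) :
    ∃ (u : X) (m : ℤ), ‖u‖ = 1 ∧ (∀ i, x i = 0 → u i = 0) ∧
      (∀ i, i ∉ Finset.Ico m (m + D) → u i = 0) ∧ s < f (inner ℂ u (A u)) := by
  -- Pigeonhole: if every window had value at most `s`, the total would be at most `s * D`, because
  -- the squared norms of the windows add up to `D`.
  by_contra! hcon
  have hle : ∀ m : ℤ, f (inner ℂ (trunc (Finset.Ico m (m + D)) x)
      (A (trunc (Finset.Ico m (m + D)) x))) ≤ s * ‖trunc (Finset.Ico m (m + D)) x‖ ^ 2 := by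
    intro m
    by_cases h0 : trunc (Finset.Ico m (m + D)) x = 0
    · simp [h0]
    obtain ⟨u, hu1, hu2, hu3⟩ := exists_unit_form A h0
    have := hcon u m hu1
      (fun i hi => hu3 i (by rw [trunc_coord, hi, ite_self]))
      (fun i hi => hu3 i (by rw [trunc_coord, if_neg hi]))
    rw [hu2, ← Complex.real_smul, map_smul, smul_eq_mul, mul_comm]
    exact mul_le_mul_of_nonneg_right this (sq_nonneg _)
  have hsum : f (∑ m ∈ windowStarts F D, inner ℂ (trunc (Finset.Ico m (m + D)) x)
      (A (trunc (Finset.Ico m (m + D)) x))) ≤ s * D := by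
    rw [map_sum]
    refine (Finset.sum_le_sum fun m _ => hle m).trans ?_
    rw [← Finset.mul_sum, sum_norm_sq_windows hx, hx1]
    simp
  have hb := norm_sum_form_windows_sub_le A hw hx D
  rw [hx1, one_pow, mul_one] at hb
  have hf := (neg_le_abs _).trans ((Real.norm_eq_abs _).symm.le.trans
    ((f.le_opNorm _).trans (mul_le_mul_of_nonneg_left hb (norm_nonneg f))))
  have hD : f (D * inner ℂ x (A x)) = D * f (inner ℂ x (A x)) := by
    have : (D : ℂ) * inner ℂ x (A x) = (D : ℝ) • inner ℂ x (A x) := by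
      rw [Complex.real_smul]; push_cast; rfl
    rw [this, map_smul, smul_eq_mul]
  rw [map_sub, hD] at hf
  linarith

end Windows

/-! ### Convexity of the numerical range. -/

section ToeplitzHausdorff

variable {H : Type*} [NormedAddCommGroup H] [InnerProductSpace ℂ H]

/-- The imaginary part equals that of `c * (P - conj Q)`, so `c` need only rotate `P - conj Q` onto
the real axis. -/
theorem exists_phase (P Q : ℂ) :
    ∃ c : ℂ, ‖c‖ = 1 ∧ (c * P + (starRingEnd ℂ) c * Q).im = 0 := by
  set r : ℂ := P - (starRingEnd ℂ) Q with hr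
  have key : ∀ c : ℂ, (c * P + (starRingEnd ℂ) c * Q).im = (c * r).im := by
    intro c
    simp [hr, Complex.mul_im]
    ring
  by_cases h : r = 0
  · exact ⟨1, by simp, by rw [key, h]; simp⟩
  · have hn : ‖r‖ ≠ 0 := norm_ne_zero_iff.mpr h
    refine ⟨(starRingEnd ℂ) r / ‖r‖, ?_, ?_⟩
    · rw [norm_div, RCLike.norm_conj, Complex.norm_real, norm_norm, div_self hn]
    · rw [key, div_mul_eq_mul_div, mul_comm, Complex.mul_conj, ← Complex.ofReal_div]
      exact Complex.ofReal_im _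

/-- The **Toeplitz-Hausdorff theorem**. -/
theorem convex_form_values (A : H →L[ℂ] H) :
    Convex ℝ {z : ℂ | ∃ x : H, ‖x‖ = 1 ∧ z = inner ℂ x (A x)} := by
  rintro a ⟨x, hx, hxa⟩ b ⟨y, hy, hyb⟩ α β hα hβ hαβ
  by_cases hab : a = b
  · refine ⟨x, hx, ?_⟩
    rw [← hab, ← add_smul, hαβ, one_smul, hxa]
  have hba : b - a ≠ 0 := sub_ne_zero.mpr (Ne.symm hab)
  -- Normalise to `(A - a) / (b - a)`, with form `0` at `x` and `1` at `y`. The phase `c` on `y`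
  -- makes the cross term a real number `ρ`, so the form is real along the path from `x` to `c • y`.
  obtain ⟨c, hc, him⟩ := exists_phase ((inner ℂ x (A y) - a * inner ℂ x y) / (b - a))
    ((inner ℂ y (A x) - a * inner ℂ y x) / (b - a))
  set ρ : ℝ := (c * ((inner ℂ x (A y) - a * inner ℂ x y) / (b - a)) +
    (starRingEnd ℂ) c * ((inner ℂ y (A x) - a * inner ℂ y x) / (b - a))).re with hρ
  have hρ' : c * (inner ℂ x (A y) - a * inner ℂ x y) +
      (starRingEnd ℂ) c * (inner ℂ y (A x) - a * inner ℂ y x) = (b - a) * ρ := by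
    have h1 := Complex.re_add_im (c * ((inner ℂ x (A y) - a * inner ℂ x y) / (b - a)) +
      (starRingEnd ℂ) c * ((inner ℂ y (A x) - a * inner ℂ y x) / (b - a)))
    rw [him, ← hρ] at h1
    rw [show (ρ : ℂ) = _ from by simpa using h1]
    field_simp
  have hxx : inner ℂ x x = (1 : ℂ) := by rw [inner_self_eq_norm_sq_to_K, hx]; simp
  have hyy : inner ℂ y y = (1 : ℂ) := by rw [inner_self_eq_norm_sq_to_K, hy]; simp
  have hcc : (starRingEnd ℂ) c * c = 1 := by
    rw [mul_comm, Complex.mul_conj, Complex.normSq_eq_norm_sq, hc]; simp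
  let v : ℝ → H := fun s => ((1 - s : ℝ) : ℂ) • x + ((s : ℂ) * c) • y
  have hform : ∀ s : ℝ, inner ℂ (v s) (A (v s)) =
      a * ((‖v s‖ ^ 2 : ℝ) : ℂ) + (b - a) * ((s ^ 2 + s * (1 - s) * ρ : ℝ) : ℂ) := by
    intro s
    have h1 : ((‖v s‖ ^ 2 : ℝ) : ℂ) = inner ℂ (v s) (v s) := by
      rw [inner_self_eq_norm_sq_to_K]; push_cast; rfl
    have h2 : inner ℂ (v s) (A (v s)) - a * inner ℂ (v s) (v s) =
        (s : ℂ) ^ 2 * ((starRingEnd ℂ) c * c) * (b - a) +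
        s * (1 - s) * (c * (inner ℂ x (A y) - a * inner ℂ x y) +
          (starRingEnd ℂ) c * (inner ℂ y (A x) - a * inner ℂ y x)) := by
      simp only [v, map_add, map_smul, inner_add_left, inner_add_right, inner_smul_left,
        inner_smul_right, ← hxa, ← hyb, hxx, hyy, map_mul, Complex.conj_ofReal]
      push_cast
      ring
    rw [hρ', hcc] at h2
    rw [h1]
    push_cast
    linear_combination h2
  -- If the path met zero, `x` and `y` would be parallel, forcing `a = b`.
  have hv0 : ∀ s : ℝ, v s ≠ 0 := by
    intro s hs
    have h0 := hform s
    have hsc : ((1 - s : ℝ) : ℂ) • x = -(((s : ℂ) * c) • y) := eq_neg_of_add_eq_zero_left hs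
    have hnorm : |1 - s| = |s| := by
      have := congrArg norm hsc
      rw [norm_neg, norm_smul, norm_smul, norm_mul, hx, hy, hc, Complex.norm_real,
        Complex.norm_real] at this
      simpa using this
    have h3 : inner ℂ (((1 - s : ℝ) : ℂ) • x) (A (((1 - s : ℝ) : ℂ) • x)) =
        inner ℂ (((s : ℂ) * c) • y) (A (((s : ℂ) * c) • y)) := by
      rw [hsc, map_neg, inner_neg_neg]
    simp only [map_smul, inner_smul_left, inner_smul_right, ← hxa, ← hyb, map_mul,
      Complex.conj_ofReal] at h3
    have h4 : (1 - s) ^ 2 = s ^ 2 := sq_eq_sq_iff_abs_eq_abs _ _ |>.mpr hnorm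
    have h5 : s = 1 / 2 := by linarith
    subst h5
    push_cast at h3
    apply hba
    linear_combination (-4 : ℂ) * h3 - b * hcc
  have hvc : Continuous v := by fun_prop
  have hg : ContinuousOn (fun s : ℝ => (s ^ 2 + s * (1 - s) * ρ) / ‖v s‖ ^ 2) (Set.Icc 0 1) := by
    refine Continuous.continuousOn (Continuous.div (by fun_prop) (by fun_prop) fun s => ?_)
    exact pow_ne_zero 2 (norm_ne_zero_iff.mpr (hv0 s))
  have hv1 : ‖v 1‖ = 1 := by simp [v, norm_smul, hc, hy]
  obtain ⟨s, -, hs⟩ := intermediate_value_Icc (zero_le_one' ℝ) hg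
    (show β ∈ _ by simp [hv1]; exact ⟨hβ, by linarith⟩)
  have hn : ‖v s‖ ≠ 0 := norm_ne_zero_iff.mpr (hv0 s)
  refine ⟨((‖v s‖⁻¹ : ℝ) : ℂ) • v s, ?_, ?_⟩
  · rw [norm_smul, Complex.norm_real, norm_inv, norm_norm, inv_mul_cancel₀ hn]
  · rw [map_smul, inner_smul_left, inner_smul_right, Complex.conj_ofReal, hform]
    have h6 : s ^ 2 + s * (1 - s) * ρ = β * ‖v s‖ ^ 2 := by
      rw [← hs]; field_simp
    rw [h6]
    have hnC : (‖v s‖ : ℂ) ≠ 0 := Complex.ofReal_ne_zero.mpr hn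
    have hαC : (α : ℂ) = 1 - β := by
      rw [show α = 1 - β by linarith]; push_cast; ring
    simp only [Complex.real_smul, hαC]
    push_cast
    field_simp
    ring

theorem convex_numericalRange (A : X →L[ℂ] X) : Convex ℝ (numericalRange A) :=
  (convex_form_values A).closure

end ToeplitzHausdorff

/-! ### Shifts, weak convergence and compact perturbations. -/

section Shifts

theorem shift_apply (k : ℤ) (x : X) (j : ℤ) : shift k x j = x (j - k) := rfl

theorem norm_shift_apply (k : ℤ) (x : X) : ‖shift k x‖ = ‖x‖ := norm_shift k x

theorem shift_shift_neg (k : ℤ) (x : X) : shift k (shift (-k) x) = x := by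
  ext j
  simp [shift_apply]

theorem inner_shift_shift (k : ℤ) (x y : X) : inner ℂ (shift k x) (shift k y) = inner ℂ x y := by
  rw [lp.inner_eq_tsum, lp.inner_eq_tsum]
  exact (Equiv.subRight k).tsum_eq fun i => inner ℂ (x i) (y i)

theorem inner_shift_neg (k : ℤ) (x y : X) :
    inner ℂ x (shift (-k) y) = inner ℂ (shift k x) y := by
  rw [← inner_shift_shift k, shift_shift_neg]

theorem shift_e (k j : ℤ) : shift k (e j) = e (j + k) := by
  ext i
  simp only [shift_apply, e_apply, sub_eq_iff_eq_add]

/-- The translate `V_{-k} A V_k`. -/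
def translate (A : X →L[ℂ] X) (k : ℤ) : X →L[ℂ] X := (shift (-k)).comp (A.comp (shift k))

theorem translate_apply (A : X →L[ℂ] X) (k : ℤ) (x : X) :
    translate A k x = shift (-k) (A (shift k x)) := rfl

theorem norm_translate_apply_le (A : X →L[ℂ] X) (k : ℤ) (x : X) :
    ‖translate A k x‖ ≤ ‖A‖ * ‖x‖ := by
  rw [translate_apply, norm_shift_apply, ← norm_shift_apply k x]
  exact A.le_opNorm _

theorem inner_translate (A : X →L[ℂ] X) (k : ℤ) (x y : X) :
    inner ℂ x (translate A k y) = inner ℂ (shift k x) (A (shift k y)) := by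
  rw [translate_apply, inner_shift_neg]

theorem translate_e_apply (A : X →L[ℂ] X) (k i j : ℤ) :
    translate A k (e j) i = entry A (i + k) (j + k) := by
  rw [← inner_e_left, inner_translate, shift_e, shift_e, entry]

theorem tendsto_apply_of_tendsto_abs {h : ℕ → ℤ} (hh : Tendsto (fun m => |h m|) atTop atTop)
    (y : X) (j : ℤ) : Tendsto (fun m => y (j + h m)) atTop (𝓝 0) := by
  have hcof : Tendsto h atTop cofinite := by
    rw [Int.cofinite_eq, ← comap_abs_atTop, tendsto_comap_iff]
    exact hh
  have hj : Tendsto (fun m => j + h m) atTop cofinite :=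
    (add_right_injective j).tendsto_cofinite.comp hcof
  have hy : Tendsto (fun i => ‖y i‖ ^ (2 : ENNReal).toReal) cofinite (𝓝 0) :=
    ((lp.memℓp y).summable (by norm_num)).tendsto_cofinite_zero
  have hy2 : Tendsto (fun i => ‖y i‖) cofinite (𝓝 0) := by
    have := hy.sqrt
    simpa [Real.sqrt_sq] using this
  exact (tendsto_zero_iff_norm_tendsto_zero.mpr hy2).comp hj

theorem exists_norm_sub_trunc_lt (x : X) {ε : ℝ} (hε : 0 < ε) :
    ∃ s : Finset ℤ, ‖x - trunc s x‖ < ε := by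
  obtain ⟨s, hs⟩ := ((tendsto_trunc x).eventually (Metric.ball_mem_nhds x hε)).exists
  refine ⟨s, ?_⟩
  rwa [dist_comm, dist_eq_norm] at hs

/-- The translates `V_{h_m} x` converge weakly to zero. -/
theorem tendsto_inner_shift {h : ℕ → ℤ} (hh : Tendsto (fun m => |h m|) atTop atTop)
    (x y : X) : Tendsto (fun m => inner ℂ (shift (h m) x) y) atTop (𝓝 0) := by
  have hfin : ∀ s : Finset ℤ,
      Tendsto (fun m => inner ℂ (shift (h m) (trunc s x)) y) atTop (𝓝 0) := by
    intro s
    have h1 : ∀ m, inner ℂ (shift (h m) (trunc s x)) y =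
        ∑ j ∈ s, (starRingEnd ℂ) (x j) * y (j + h m) := by
      intro m
      rw [trunc_apply, map_sum, sum_inner]
      refine Finset.sum_congr rfl fun j _ => ?_
      rw [map_smul, inner_smul_left, shift_e, inner_e_left]
    simp only [h1]
    rw [← Finset.sum_const_zero (s := s)]
    refine tendsto_finsetSum _ fun j _ => ?_
    simpa using (tendsto_apply_of_tendsto_abs hh y j).const_mul ((starRingEnd ℂ) (x j))
  rw [Metric.tendsto_atTop]
  intro ε hε
  obtain ⟨s, hs⟩ := exists_norm_sub_trunc_lt x (ε := ε / (2 * (‖y‖ + 1))) (by positivity)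
  obtain ⟨N, hN⟩ := Metric.tendsto_atTop.mp (hfin s) (ε / 2) (by positivity)
  refine ⟨N, fun m hm => ?_⟩
  have h2 := hN m hm
  rw [dist_zero_right] at h2 ⊢
  have h3 : inner ℂ (shift (h m) x) y =
      inner ℂ (shift (h m) (trunc s x)) y + inner ℂ (shift (h m) (x - trunc s x)) y := by
    rw [← inner_add_left, ← map_add, add_sub_cancel]
  have h4 : ‖inner ℂ (shift (h m) (x - trunc s x)) y‖ ≤ ε / 2 := by
    refine (norm_inner_le_norm _ _).trans ?_
    rw [norm_shift_apply]
    calc _ ≤ ε / (2 * (‖y‖ + 1)) * (‖y‖ + 1) := by gcongr; linarith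
      _ = ε / 2 := by field_simp
  rw [h3]
  exact (norm_add_le _ _).trans_lt (by linarith)

/-- Along a subsequence the images under `K` converge in norm to some `y`; pairing with `y` vanishes
by weak convergence, and the rest by Cauchy-Schwarz. -/
theorem tendsto_inner_compact {K : X →L[ℂ] X} (hK : IsCompactOperator K) {h : ℕ → ℤ}
    (hh : Tendsto (fun m => |h m|) atTop atTop) (x : X) :
    Tendsto (fun m => inner ℂ (shift (h m) x) (K (shift (h m) x))) atTop (𝓝 0) := by
  refine tendsto_of_subseq_tendsto fun ns hns => ?_
  obtain ⟨S, hS, hsub⟩ := IsCompactOperator.image_closedBall_subset_compact (f := K.toLinearMap)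
    hK ‖x‖
  obtain ⟨y, -, φ, hφ, hy⟩ := hS.tendsto_subseq (x := fun n => K (shift (h (ns n)) x))
    (fun n => hsub ⟨shift (h (ns n)) x, by simp [norm_shift_apply], rfl⟩)
  refine ⟨φ, ?_⟩
  have hsubseq : Tendsto (fun n => ns (φ n)) atTop atTop := hns.comp hφ.tendsto_atTop
  have h1 : Tendsto (fun n => inner ℂ (shift (h (ns (φ n))) x) y) atTop (𝓝 0) :=
    (tendsto_inner_shift hh x y).comp hsubseq
  have h2 : Tendsto (fun n => inner ℂ (shift (h (ns (φ n))) x)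
      (K (shift (h (ns (φ n))) x) - y)) atTop (𝓝 0) := by
    have h3 : Tendsto (fun n => ‖x‖ * ‖K (shift (h (ns (φ n))) x) - y‖) atTop (𝓝 0) := by
      have := (tendsto_iff_norm_sub_tendsto_zero.mp hy).const_mul ‖x‖
      simpa using this
    refine squeeze_zero_norm (fun n => ?_) h3
    refine (norm_inner_le_norm _ _).trans ?_
    rw [norm_shift_apply]
  have h4 := h1.add h2
  simp only [← inner_add_right, add_sub_cancel, add_zero] at h4
  exact h4

/-- The numerical range of a limit operator is contained in that of every compact perturbation. -/
theorem numericalRange_subset_of_mem_operatorSpectrum {A B K : X →L[ℂ] X}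
    (hB : B ∈ operatorSpectrum A) (hK : IsCompactOperator K) :
    numericalRange B ⊆ numericalRange (A + K) := by
  obtain ⟨h, hh, hlim⟩ := hB
  refine closure_minimal ?_ isClosed_closure
  rintro z ⟨x, hx, rfl⟩
  have h1 : Tendsto (fun m => inner ℂ (shift (h m) x) (A (shift (h m) x))) atTop
      (𝓝 (inner ℂ x (B x))) := by
    have := (tendsto_const_nhds (x := x)).inner (𝕜 := ℂ) (hlim x)
    simpa only [inner_shift_neg] using this
  have h2 := h1.add (tendsto_inner_compact hK hh x)
  rw [add_zero] at h2
  refine mem_closure_of_tendsto h2 (Eventually.of_forall fun m => ?_)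
  refine ⟨shift (h m) x, by rw [norm_shift_apply, hx], ?_⟩
  rw [add_apply, inner_add_right]

end Shifts

/-! ### Existence of limit operators. -/

section LimitOperators

theorem cauchySeq_of_cauchySeq_e {T : ℕ → X →L[ℂ] X} {M : ℝ}
    (hT : ∀ m x, ‖T m x‖ ≤ M * ‖x‖) (he : ∀ j, CauchySeq fun m => T m (e j)) (x : X) :
    CauchySeq fun m => T m x := by
  have hM : 0 ≤ M := by
    have := (norm_nonneg _).trans (hT 0 (e 0))
    rwa [norm_e, mul_one] at this
  have hfin : ∀ s : Finset ℤ, CauchySeq fun m => T m (trunc s x) := by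
    intro s
    simp only [trunc_apply, map_sum, map_smul]
    have hlim : ∀ j, ∃ y, Tendsto (fun m => T m (e j)) atTop (𝓝 y) :=
      fun j => cauchySeq_tendsto_of_complete (he j)
    choose y hy using hlim
    exact (tendsto_finsetSum s fun j _ => (hy j).const_smul (x j)).cauchySeq
  rw [Metric.cauchySeq_iff]
  intro ε hε
  obtain ⟨s, hs⟩ := exists_norm_sub_trunc_lt x (ε := ε / (4 * (M + 1))) (by positivity)
  obtain ⟨N, hN⟩ := Metric.cauchySeq_iff.mp (hfin s) (ε / 2) (by positivity)
  refine ⟨N, fun m hm n hn => ?_⟩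
  have hsmall : ∀ m, ‖T m (x - trunc s x)‖ ≤ ε / 4 := by
    intro m
    refine (hT m _).trans ?_
    calc _ ≤ (M + 1) * (ε / (4 * (M + 1))) := by gcongr; linarith
      _ = ε / 4 := by field_simp
  have h1 := hN m hm n hn
  rw [dist_eq_norm] at h1 ⊢
  have h2 : T m x - T n x = (T m (trunc s x) - T n (trunc s x)) +
      (T m (x - trunc s x) - T n (x - trunc s x)) := by
    rw [map_sub, map_sub]; abel
  have h3 := norm_sub_le (T m (x - trunc s x)) (T n (x - trunc s x))
  rw [h2]
  refine (norm_add_le _ _).trans_lt ?_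
  linarith [hsmall m, hsmall n]

/-- Band operators are rich: every sequence tending to infinity has a subsequence along which the
limit operator exists. -/
theorem exists_isLimitOperatorAlong {A : X →L[ℂ] X} {w : ℕ}
    (hw : ∀ i j : ℤ, (w : ℤ) < |i - j| → entry A i j = 0) {h : ℕ → ℤ}
    (hh : Tendsto (fun m => |h m|) atTop atTop) :
    ∃ (φ : ℕ → ℕ) (B : X →L[ℂ] X), StrictMono φ ∧ IsLimitOperatorAlong A (h ∘ φ) B := by
  have hcpt : IsCompact (Set.univ.pi fun _ : ℤ × ℤ => Metric.closedBall (0 : ℂ) ‖A‖) :=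
    isCompact_univ_pi fun _ => isCompact_closedBall _ _
  -- Sequential compactness of a countable product of discs replaces a diagonal argument over the
  -- matrix entries.
  obtain ⟨b, -, φ, hφ, hb⟩ := hcpt.tendsto_subseq
    (x := fun m (p : ℤ × ℤ) => entry A (p.1 + h m) (p.2 + h m))
    (fun m p _ => by simpa using norm_entry_le A _ _)
  rw [tendsto_pi_nhds] at hb
  -- Each column is a finite sum over a range independent of `k`, so convergence of entries gives
  -- norm convergence of columns.
  have hexp : ∀ k j : ℤ, translate A k (e j) =
      ∑ i ∈ Finset.Icc (j - w) (j + w), entry A (i + k) (j + k) • e i := by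
    intro k j
    have : translate A k (e j) = trunc (Finset.Icc (j - w) (j + w)) (translate A k (e j)) := by
      ext i
      rw [trunc_coord]
      split_ifs with hi
      · rfl
      · rw [translate_e_apply]
        refine hw _ _ ?_
        rw [Finset.mem_Icc] at hi
        rw [Int.abs_eq_natAbs]
        omega
    rw [this, trunc_apply]
    exact Finset.sum_congr rfl fun i _ => by rw [translate_e_apply]
  have hcau : ∀ x, CauchySeq fun m => translate A (h (φ m)) x := by
    refine cauchySeq_of_cauchySeq_e (fun m x => norm_translate_apply_le A _ x) fun j => ?_
    simp only [hexp]
    exact (tendsto_finsetSum _ fun i _ => (hb (i, j)).smul_const (e i)).cauchySeq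
  have hlim : ∀ x, ∃ y, Tendsto (fun m => translate A (h (φ m)) x) atTop (𝓝 y) :=
    fun x => cauchySeq_tendsto_of_complete (hcau x)
  choose B hB using hlim
  refine ⟨φ, continuousLinearMapOfTendsto (fun m => translate A (h (φ m)))
    (tendsto_pi_nhds.mpr hB), hφ, hh.comp hφ.tendsto_atTop, fun x => hB x⟩

/-- Only the columns in `s` matter, and coordinates of a unit vector are at most `1`. This makes
strong convergence uniform over unit vectors supported in `s`. -/
theorem norm_form_sub_le {S T : X →L[ℂ] X} {s : Finset ℤ} {v : X} (hv : trunc s v = v)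
    (hv1 : ‖v‖ = 1) :
    ‖inner ℂ v (S v) - inner ℂ v (T v)‖ ≤ ∑ j ∈ s, ‖S (e j) - T (e j)‖ := by
  have h1 : S v - T v = ∑ j ∈ s, v j • (S (e j) - T (e j)) := by
    conv_lhs => rw [← hv, trunc_apply]
    simp only [map_sum, map_smul, smul_sub, Finset.sum_sub_distrib]
  rw [← inner_sub_right]
  refine (norm_inner_le_norm _ _).trans ?_
  rw [hv1, one_mul, h1]
  refine (norm_sum_le _ _).trans (Finset.sum_le_sum fun j _ => ?_)
  rw [norm_smul]
  have := norm_apply_le v j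
  rw [hv1] at this
  exact mul_le_of_le_one_left (norm_nonneg _) this

end LimitOperators

/-! ### Form values far from the origin. -/

section OuterValues

/-- The values of the quadratic form of `A` at finitely supported unit vectors that vanish on
`[-n, n]`. -/
def outerValues (A : X →L[ℂ] X) (n : ℕ) : Set ℂ :=
  {z | ∃ (x : X) (F : Finset ℤ), ‖x‖ = 1 ∧ trunc F x = x ∧ (∀ j : ℤ, |j| ≤ n → x j = 0) ∧
    z = inner ℂ x (A x)}

/-- The closed convex hull of `outerValues A n`. -/
def outerHull (A : X →L[ℂ] X) (n : ℕ) : Set ℂ := closure (convexHull ℝ (outerValues A n))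

theorem outerValues_antitone (A : X →L[ℂ] X) : Antitone (outerValues A) := by
  rintro m n hmn z ⟨x, F, h1, h2, h3, h4⟩
  exact ⟨x, F, h1, h2, fun j hj => h3 j (hj.trans (by exact_mod_cast hmn)), h4⟩

theorem outerHull_antitone (A : X →L[ℂ] X) : Antitone (outerHull A) :=
  fun _ _ hmn => closure_mono (convexHull_mono (outerValues_antitone A hmn))

theorem outerValues_subset_outerHull (A : X →L[ℂ] X) (n : ℕ) :
    outerValues A n ⊆ outerHull A n := (subset_convexHull ℝ _).trans subset_closure

theorem convex_outerHull (A : X →L[ℂ] X) (n : ℕ) : Convex ℝ (outerHull A n) :=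
  (convex_convexHull ℝ _).closure

theorem isCompact_outerHull (A : X →L[ℂ] X) (n : ℕ) : IsCompact (outerHull A n) := by
  refine (isCompact_closedBall (0 : ℂ) ‖A‖).of_isClosed_subset isClosed_closure
    (closure_minimal (convexHull_min ?_ (convex_closedBall _ _)) Metric.isClosed_closedBall)
  rintro z ⟨x, F, hx, -, -, rfl⟩
  rw [mem_closedBall_zero_iff]
  refine (norm_inner_le_norm _ _).trans ?_
  have := A.le_opNorm x
  rw [hx] at this ⊢
  simpa using this

theorem trunc_eq_self_iff (s : Finset ℤ) (x : X) : trunc s x = x ↔ ∀ i ∉ s, x i = 0 := by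
  constructor
  · intro h i hi
    rw [← h, trunc_coord, if_neg hi]
  · intro h
    ext i
    rw [trunc_coord]
    split_ifs with hi
    · rfl
    · exact (h i hi).symm

theorem form_mem_outerHull (A : X →L[ℂ] X) {n : ℕ} {x : X} (hx : ‖x‖ = 1)
    (hxn : ∀ j : ℤ, |j| ≤ n → x j = 0) : inner ℂ x (A x) ∈ outerHull A n := by
  refine closure_mono (subset_convexHull ℝ (outerValues A n)) ?_
  have ht := tendsto_trunc x
  have hnorm : Tendsto (fun s => ‖trunc s x‖) atTop (𝓝 1) := hx ▸ ht.norm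
  have hform : Tendsto (fun s => inner ℂ (trunc s x) (A (trunc s x))) atTop
      (𝓝 (inner ℂ x (A x))) := ht.inner ((A.continuous.tendsto x).comp ht)
  have hquot : Tendsto (fun s => inner ℂ (trunc s x) (A (trunc s x)) /
      ((‖trunc s x‖ ^ 2 : ℝ) : ℂ)) atTop (𝓝 (inner ℂ x (A x))) := by
    have h2 : Tendsto (fun s => ((‖trunc s x‖ ^ 2 : ℝ) : ℂ)) atTop (𝓝 1) := by
      have := (Complex.continuous_ofReal.tendsto _).comp (hnorm.pow 2)
      rw [one_pow, Complex.ofReal_one] at this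
      exact this
    have h3 := hform.div h2 one_ne_zero
    rw [div_one] at h3
    exact h3
  refine mem_closure_of_tendsto hquot ?_
  filter_upwards [hnorm.eventually (lt_mem_nhds zero_lt_one)] with s hs
  obtain ⟨u, hu1, hu2, hu3⟩ := exists_unit_form A (norm_pos_iff.mp hs)
  refine ⟨u, s, hu1, (trunc_eq_self_iff s u).mpr fun i hi => hu3 i ?_, fun j hj => hu3 j ?_, ?_⟩
  · rw [trunc_coord, if_neg hi]
  · rw [trunc_coord, hxn j hj, ite_self]
  · rw [hu2, mul_div_cancel_left₀]
    exact Complex.ofReal_ne_zero.mpr (pow_ne_zero 2 hs.ne')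

/-- With `P` the projection onto `[-n, n]`, a compact `K` turns `A + K` into `(1 - P) A (1 - P) + c
P`. Its values at unit vectors are convex combinations of `c` and outer values, so it suffices to
take `c` in the hull. -/
theorem iInter_numericalRange_subset_outerHull (A : X →L[ℂ] X) (n : ℕ) :
    (⋂ K ∈ {K : X →L[ℂ] X | IsCompactOperator K}, numericalRange (A + K)) ⊆ outerHull A n := by
  intro z hz
  set P : X →L[ℂ] X := trunc (Finset.Icc (-(n : ℤ)) n) with hP
  set c : ℂ := inner ℂ (e (n + 1)) (A (e (n + 1))) with hc
  have hcmem : c ∈ outerHull A n := by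
    refine form_mem_outerHull A (norm_e _) fun j hj => ?_
    rw [e_apply, if_neg]
    rw [Int.abs_eq_natAbs] at hj
    omega
  have hPc : IsCompactOperator P := isCompactOperator_trunc _
  let K : X →L[ℂ] X := P.comp (A.comp P) - A.comp P - P.comp A + c • P
  have hK : IsCompactOperator K :=
    (((hPc.comp_clm (A.comp P)).sub (hPc.clm_comp A)).sub (hPc.comp_clm A)).add (hPc.smul c)
  rw [Set.mem_iInter₂] at hz
  refine closure_minimal ?_ isClosed_closure (hz K hK)
  rintro _ ⟨x, hx, rfl⟩
  set y : X := x - P x with hy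
  have hval : inner ℂ x ((A + K) x) = inner ℂ y (A y) + c * ((‖P x‖ ^ 2 : ℝ) : ℂ) := by
    have h1 : inner ℂ y (A y) = inner ℂ x (A y - P (A y)) := by
      rw [inner_sub_right, hP, inner_trunc_right, ← inner_sub_left]
    have h2 : (A + K) x = (A y - P (A y)) + c • P x := by
      change A x + (P (A (P x)) - A (P x) - P (A x) + c • P x) = _
      rw [hy]
      simp only [map_sub]
      abel
    rw [h2, inner_add_right, inner_smul_right, h1, hP, inner_trunc_self]
  have hsum : ‖P x‖ ^ 2 + ‖y‖ ^ 2 = 1 := by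
    rw [hy, hP, norm_sq_add_norm_sq_sub_trunc, hx, one_pow]
  have hyn : ∀ j : ℤ, |j| ≤ n → y j = 0 := by
    intro j hj
    rw [hy, lp.coeFn_sub, Pi.sub_apply, hP, trunc_coord, if_pos, sub_self]
    rw [Finset.mem_Icc]
    exact abs_le.mp hj
  rw [hval]
  change _ ∈ outerHull A n
  by_cases hy0 : y = 0
  · rw [hy0, norm_zero] at hsum
    have h3 : ‖P x‖ ^ 2 = 1 := by linarith
    rw [hy0, h3]
    simpa using hcmem
  · obtain ⟨u, hu1, hu2, hu3⟩ := exists_unit_form A hy0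
    have hu := form_mem_outerHull A hu1 fun j hj => hu3 j (hyn j hj)
    have := convex_outerHull A n hcmem hu (sq_nonneg ‖P x‖) (sq_nonneg ‖y‖) hsum
    rw [hu2, add_comm, mul_comm c]
    simpa only [Complex.real_smul] using this

end OuterValues

/-! ### Extreme points are attained by limit operators. -/

section ExtremePoints

variable {A : X →L[ℂ] X} {a : ℂ}

/-- The quadratic form takes values close to an extreme point at vectors supported far out. -/
theorem exists_outer_near_extremePoint (ha : a ∈ (⋂ n, outerHull A n).extremePoints ℝ) {ε : ℝ}
    (hε : 0 < ε) (M : ℕ) :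
    ∃ (x : X) (F : Finset ℤ), ‖x‖ = 1 ∧ trunc F x = x ∧ (∀ j : ℤ, |j| ≤ M → x j = 0) ∧
      dist (inner ℂ x (A x)) a < ε := by
  obtain ⟨f, s, n, hs, hf⟩ := exists_slice_of_iInter (isCompact_outerHull A) (convex_outerHull A)
    (outerHull_antitone A) ha hε
  have haM : a ∈ outerHull A (max M n) := Set.mem_iInter.mp ha.1 _
  -- Otherwise the hull, and hence `a`, would lie in the half-plane `f ≤ s`.
  obtain ⟨z, hz, hsz⟩ : ∃ z ∈ outerValues A (max M n), s < f z := by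
    by_contra! hcon
    have hsub : outerHull A (max M n) ⊆ {p | f p ≤ s} :=
      closure_minimal (convexHull_min hcon (convex_halfSpace_le f.isLinear s))
        (isClosed_le f.continuous continuous_const)
    exact absurd (hsub haM) (not_le.mpr hs)
  have hd := hf z (outerHull_antitone A (le_max_right M n)
    (outerValues_subset_outerHull A _ hz)) hsz.le
  obtain ⟨x, F, h1, h2, h3, rfl⟩ := hz
  exact ⟨x, F, h1, h2, fun j hj => h3 j (hj.trans (by exact_mod_cast le_max_left M n)), hd⟩

/-- A finitely supported unit vector whose form value is close to an extreme point has a window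
whose form value is still close to it; the window length depends only on the tolerance. -/
theorem exists_window_near_extremePoint {w : ℕ}
    (hw : ∀ i j : ℤ, (w : ℤ) < |i - j| → entry A i j = 0)
    (ha : a ∈ (⋂ n, outerHull A n).extremePoints ℝ) {ε : ℝ} (hε : 0 < ε) :
    ∃ (δ : ℝ) (n D : ℕ), 0 < δ ∧ ∀ (x : X) (F : Finset ℤ), ‖x‖ = 1 → trunc F x = x →
      (∀ j : ℤ, |j| ≤ n → x j = 0) → dist (inner ℂ x (A x)) a < δ →
      ∃ (u : X) (m : ℤ), ‖u‖ = 1 ∧ (∀ i, x i = 0 → u i = 0) ∧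
        (∀ i, i ∉ Finset.Ico m (m + D) → u i = 0) ∧ dist (inner ℂ u (A u)) a < ε := by
  obtain ⟨f, s, n, hs, hf⟩ := exists_slice_of_iInter (isCompact_outerHull A) (convex_outerHull A)
    (outerHull_antitone A) ha hε
  -- Half the gap absorbs the distance from the value at `x` to `a`, the other half the window
  -- error, once `D` is large.
  set η : ℝ := (f a - s) / 2 with hη
  have hη0 : 0 < η := by rw [hη]; linarith
  obtain ⟨D, hD⟩ := exists_nat_gt (‖f‖ * (w * ‖A‖ * (2 * w + 1)) / η)
  rw [div_lt_iff₀ hη0] at hD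
  refine ⟨η / (‖f‖ + 1), n, D, by positivity, fun x F hx hF hxn hxa => ?_⟩
  have hfx : s + η ≤ f (inner ℂ x (A x)) := by
    have h1 : ‖f (inner ℂ x (A x) - a)‖ ≤ η := by
      refine (f.le_opNorm _).trans ?_
      rw [← dist_eq_norm]
      calc _ ≤ (‖f‖ + 1) * (η / (‖f‖ + 1)) := by gcongr; linarith
        _ = η := by field_simp
    rw [map_sub, Real.norm_eq_abs] at h1
    have h2 := (abs_le.mp h1).1
    linarith
  obtain ⟨u, m, hu1, hu2, hu3, hu4⟩ := exists_window A hw hF hx D f s (by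
    have h3 : (D : ℝ) * (s + η) ≤ D * f (inner ℂ x (A x)) :=
      mul_le_mul_of_nonneg_left hfx (Nat.cast_nonneg D)
    linarith)
  refine ⟨u, m, hu1, hu2, hu3, hf _ (outerValues_subset_outerHull A n ?_) hu4.le⟩
  exact ⟨u, F, hu1, (trunc_eq_self_iff F u).mpr fun i hi =>
    hu2 i ((trunc_eq_self_iff F x).mp hF i hi), fun j hj => hu2 j (hxn j hj), rfl⟩

/-- Nested windows: all the windows contain a common index `j`. -/
theorem exists_nested_windows {δ : ℝ → ℝ} {n D : ℝ → ℕ}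
    (hwin : ∀ ε, 0 < ε → ∀ (x : X) (F : Finset ℤ), ‖x‖ = 1 → trunc F x = x →
      (∀ j : ℤ, |j| ≤ n ε → x j = 0) → dist (inner ℂ x (A x)) a < δ ε →
      ∃ (u : X) (m : ℤ), ‖u‖ = 1 ∧ (∀ i, x i = 0 → u i = 0) ∧
        (∀ i, i ∉ Finset.Ico m (m + D ε) → u i = 0) ∧ dist (inner ℂ u (A u)) a < ε)
    {ε : ℕ → ℝ} (hε : ∀ k, 0 < ε k) (hεδ : ∀ k, ε (k + 1) ≤ δ (ε k)) (M N : ℕ)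
    (hM : ∀ k < N, n (ε k) ≤ M) (x : X) (F : Finset ℤ) (hx : ‖x‖ = 1) (hF : trunc F x = x)
    (hxM : ∀ j : ℤ, |j| ≤ M → x j = 0) (hxa : dist (inner ℂ x (A x)) a < ε N) :
    ∃ j : ℤ, x j ≠ 0 ∧ ∀ k < N, ∃ u : X, ‖u‖ = 1 ∧ (∀ i, u i ≠ 0 → |i - j| < D (ε k)) ∧
      dist (inner ℂ u (A u)) a < ε k := by
  -- Each step cuts `x` to a window `u`, loosening the tolerance from `ε (N + 1)` to `ε N`. Supports
  -- shrink, so a non-zero coordinate of the last vector lies in every window.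
  induction N generalizing x with
  | zero =>
    have hx0 : x ≠ 0 := fun h => by simp [h] at hx
    obtain ⟨j, hj⟩ : ∃ j, x j ≠ 0 := by
      by_contra! hcon
      exact hx0 (by ext j; exact hcon j)
    exact ⟨j, hj, fun k hk => absurd hk (Nat.not_lt_zero k)⟩
  | succ N ih =>
    obtain ⟨u, m, hu1, hu2, hu3, hu4⟩ := hwin (ε N) (hε N) x F hx hF
      (fun j hj => hxM j (hj.trans (by exact_mod_cast hM N (Nat.lt_succ_self N))))
      (hxa.trans_le (hεδ N))
    obtain ⟨j, hj, hk⟩ := ih (fun k hk => hM k (hk.trans (Nat.lt_succ_self N))) u hu1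
      ((trunc_eq_self_iff F u).mpr fun i hi => hu2 i ((trunc_eq_self_iff F x).mp hF i hi))
      (fun j hj => hu2 j (hxM j hj)) hu4
    refine ⟨j, fun h => hj (hu2 j h), fun k hkN => ?_⟩
    rcases Nat.lt_succ_iff_lt_or_eq.mp hkN with h | rfl
    · exact hk k h
    · refine ⟨u, hu1, fun i hi => ?_, hu4⟩
      have hi' : i ∈ Finset.Ico m (m + D (ε k)) := by
        by_contra h
        exact hi (hu3 i h)
      have hj' : j ∈ Finset.Ico m (m + D (ε k)) := by
        by_contra h
        exact hj (hu3 j h)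
      rw [Finset.mem_Ico] at hi' hj'
      rw [abs_lt]
      omega

/-- Every extreme point of the limiting outer hull is attained by some limit operator. -/
theorem extremePoint_mem_numericalRange {w : ℕ}
    (hw : ∀ i j : ℤ, (w : ℤ) < |i - j| → entry A i j = 0)
    (ha : a ∈ (⋂ n, outerHull A n).extremePoints ℝ) :
    ∃ B ∈ operatorSpectrum A, a ∈ numericalRange B := by
  have hex : ∀ ε : ℝ, ∃ (δ : ℝ) (n D : ℕ), 0 < ε → 0 < δ ∧ ∀ (x : X) (F : Finset ℤ), ‖x‖ = 1 →
      trunc F x = x → (∀ j : ℤ, |j| ≤ n → x j = 0) → dist (inner ℂ x (A x)) a < δ →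
      ∃ (u : X) (m : ℤ), ‖u‖ = 1 ∧ (∀ i, x i = 0 → u i = 0) ∧
        (∀ i, i ∉ Finset.Ico m (m + D) → u i = 0) ∧ dist (inner ℂ u (A u)) a < ε := by
    intro ε
    by_cases hε : 0 < ε
    · obtain ⟨δ, n, D, h⟩ := exists_window_near_extremePoint hw ha hε
      exact ⟨δ, n, D, fun _ => h⟩
    · exact ⟨0, 0, 0, fun h => absurd h hε⟩
  choose δ n D hwin using hex
  -- The bound `δ r` permits the next cut; `1 / (k + 1)` makes the tolerances tend to zero.
  let ε : ℕ → ℝ := fun k => Nat.rec 1 (fun k r => min (δ r) (1 / ((k : ℝ) + 1))) k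
  have hεs : ∀ k, ε (k + 1) = min (δ (ε k)) (1 / ((k : ℝ) + 1)) := fun k => rfl
  have hε : ∀ k, 0 < ε k := by
    intro k
    induction k with
    | zero => exact one_pos
    | succ k ih =>
      rw [hεs]
      exact lt_min (hwin _ ih).1 (by positivity)
  have hεδ : ∀ k, ε (k + 1) ≤ δ (ε k) := fun k => by rw [hεs]; exact min_le_left _ _
  have hnest : ∀ N : ℕ, ∃ j : ℤ, (N : ℤ) < |j| ∧ ∀ k < N, ∃ u : X, ‖u‖ = 1 ∧
      (∀ i, u i ≠ 0 → |i - j| < D (ε k)) ∧ dist (inner ℂ u (A u)) a < ε k := by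
    intro N
    -- `M ≥ N` pushes `j` to infinity; `M ≥ n (ε k)` permits all the cuts.
    set M : ℕ := max N ((Finset.range N).sup fun k => n (ε k)) with hM
    obtain ⟨x, F, hx, hF, hxM, hxa⟩ := exists_outer_near_extremePoint ha (hε N) M
    obtain ⟨j, hj, h⟩ := exists_nested_windows (fun ε hε => (hwin ε hε).2) hε hεδ M N
      (fun k hk => (Finset.le_sup (f := fun k => n (ε k)) (Finset.mem_range.mpr hk)).trans
        (le_max_right _ _)) x F hx hF hxM hxa
    refine ⟨j, ?_, h⟩
    by_contra hcon
    exact hj (hxM j ((not_lt.mp hcon).trans (by exact_mod_cast le_max_left _ _)))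
  choose h hh hu using hnest
  have hlim : Tendsto (fun m => |h m|) atTop atTop :=
    tendsto_atTop_mono (fun m => (hh m).le) tendsto_natCast_atTop_atTop
  obtain ⟨φ, B, hφ, hB⟩ := exists_isLimitOperatorAlong hw hlim
  refine ⟨B, ⟨h ∘ φ, hB⟩, Metric.mem_closure_iff.mpr fun η hη => ?_⟩
  obtain ⟨k, hk⟩ : ∃ k, ε k < η / 2 := by
    obtain ⟨k, hk⟩ := exists_nat_one_div_lt (half_pos hη)
    exact ⟨k + 1, (hεs k ▸ min_le_right _ _).trans_lt hk⟩
  -- After translation the level-`k` vectors have support in this set, independent of `m`.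
  set s : Finset ℤ := Finset.Ioo (-(D (ε k) : ℤ)) (D (ε k)) with hs
  have hconv : Tendsto (fun m => ∑ j ∈ s, ‖translate A (h (φ m)) (e j) - B (e j)‖) atTop
      (𝓝 0) := by
    rw [← Finset.sum_const_zero (s := s)]
    exact tendsto_finsetSum _ fun j _ => tendsto_iff_norm_sub_tendsto_zero.mp (hB.2 (e j))
  obtain ⟨m, hm, hmk⟩ := ((hconv.eventually (gt_mem_nhds (half_pos hη))).and
    (eventually_gt_atTop k)).exists
  obtain ⟨u, hu1, hu2, hu3⟩ := hu (φ m) k (hmk.trans_le (hφ.id_le m))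
  set v : X := shift (-h (φ m)) u with hv
  have hv1 : ‖v‖ = 1 := by rw [hv, norm_shift_apply, hu1]
  have hvs : trunc s v = v := by
    refine (trunc_eq_self_iff s v).mpr fun i hi => ?_
    by_contra h0
    have := hu2 _ h0
    apply hi
    rw [hs, Finset.mem_Ioo]
    rw [abs_lt] at this
    omega
  refine ⟨inner ℂ v (B v), ⟨v, hv1, rfl⟩, ?_⟩
  have h1 := norm_form_sub_le (S := translate A (h (φ m))) (T := B) hvs hv1
  rw [inner_translate, hv, shift_shift_neg, ← hv, ← dist_eq_norm] at h1
  rw [dist_comm] at hu3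
  have h2 := dist_triangle a (inner ℂ u (A u)) (inner ℂ v (B v))
  linarith

end ExtremePoints

end BandOperator

end
-- The two inclusions combined.
theorem mainTheorem3 (A : BandOperator.X →L[ℂ] BandOperator.X)
    (hA : BandOperator.IsBandOperator A) :
    (⋂ K ∈ {K : BandOperator.X →L[ℂ] BandOperator.X | IsCompactOperator K},
        BandOperator.numericalRange (A + K)) =
      convexHull ℝ (⋃ B ∈ BandOperator.operatorSpectrum A, BandOperator.numericalRange B) := by
  apply Set.Subset.antisymm
  · obtain ⟨w, hw⟩ := hA.exists_width
    intro z hz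
    have hz' : z ∈ ⋂ n, BandOperator.outerHull A n := Set.mem_iInter.mpr fun n =>
      BandOperator.iInter_numericalRange_subset_outerHull A n hz
    have hcpt : IsCompact (⋂ n, BandOperator.outerHull A n) :=
      (BandOperator.isCompact_outerHull A 0).of_isClosed_subset
        (isClosed_iInter fun n => (BandOperator.isCompact_outerHull A n).isClosed)
        (Set.iInter_subset _ 0)
    have hconv : Convex ℝ (⋂ n, BandOperator.outerHull A n) :=
      convex_iInter (BandOperator.convex_outerHull A)
    refine convexHull_mono ?_ (BandOperator.subset_convexHull_extremePoints hcpt hconv hz')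
    intro a ha
    obtain ⟨B, hB, haB⟩ := BandOperator.extremePoint_mem_numericalRange hw ha
    exact Set.mem_iUnion₂.mpr ⟨B, hB, haB⟩
  · refine Set.subset_iInter₂ fun K hK => convexHull_min (Set.iUnion₂_subset fun B hB => ?_)
      (BandOperator.convex_numericalRange _)
    exact BandOperator.numericalRange_subset_of_mem_operatorSpectrum hB hK
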